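/- Let $a,b,c$ be real numbers with $2<a\le b\le c<ab/2$ and $a^2+b^2+c^2=abc$. Write points of the upper half-plane $\mathcal H$ as $X+iY$, let $S^t=\begin{pmatrix}1&t\\0&1\end{pmatrix}$, and define in $\mathrm{SL}(2,\mathbb R)$ the order two elliptic elements \[T_0=\begin{pmatrix}0&-a/c\\c/a&0\end{pmatrix},\quad T_1=\begin{pmatrix}a/c&*\\b/a&-a/c\end{pmatrix},\quad T_2=\begin{pmatrix}a-b/c&*\\1&-a+b/c\end{pmatrix},\] where the entries $*$ are determined by the condition that the determinant is $1$. For $A=\begin{pmatrix}\alpha&\beta\\\gamma&-\alpha\end{pmatrix}\in\mathrm{SL}(2,\mathbb R)$ with $\gamma\ne0$ let $\mathcal U(A)=\{X+iY\in\mathcal H : |(X-\alpha/\gamma)^2-Y^2|<1/\gamma^2\}$, let $\mathcal U_-(A)$ be its part with $X<\alpha/\gamma$ and $\mathcal U_+(A)$ its part with $X\ge\alpha/\gamma$. The excision interval of $A$ is the intersection of the line $Y=a/2$ with $\mathcal U_+(A)\cup\mathcal U_-(S^aAS^{-a})$. On triples of order two elements define \[\nu(E,F,G)=(FEF,\,G,\,S^aFS^{-a}),\quad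 \rho(E,F,G)=(FGF,\,F,\,S^aES^{-a}),\quad \lambda(E,F,G)=(EFE,\,E,\,G).\] Let $\mathcal T$ be the tree whose nodes are all triples obtained from $(T_0,T_1,T_2)$ or from $\nu(T_0,T_1,T_2)$ by finite (possibly empty) compositions of $\lambda$ and $\rho$. Let $\mathcal E$ be the set of all order two elements appearing in the triple of some node of $\mathcal T$, with $T_2$ replaced by its translate $S^{-a}T_2S^{a}$. Let the ambient interval be the closed interval on the line $Y=a/2$ from the left endpoint of the intersection of the line with $\mathcal U_+(S^{-a}T_2S^{a})$ to the left endpoint of its intersection with $\mathcal U_+(T_2)$. Then the complement, in the ambient interval, of the union of the excision intervals of all $T\in\mathcal E$ has Hausdorff dimension zero. In particular, it has Lebesgue measure zero (on the line $Y=a/2$ with its Euclidean coordinate $X$). -/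

import Mathlib

open MeasureTheory
open scoped UpperHalfPlane MatrixGroups

noncomputable section

namespace Uplift

/-- A (normalized) Fricke triple: positive reals with `a² + b² + c² = abc` and
`2 < a ≤ b ≤ c < ab/2`. -/
structure FrickeTriple where
  a : ℝ
  b : ℝ
  c : ℝ
  two_lt_a : 2 < a
  a_le_b : a ≤ b
  b_le_c : b ≤ c
  c_lt : c < a * b / 2
  fricke : a ^ 2 + b ^ 2 + c ^ 2 = a * b * c

/-- The translation `S^t : z ↦ z + t`. -/
def S (t : ℝ) : SL(2, ℝ) :=
  ⟨!![1, t; 0, 1], by simp [Matrix.det_fin_two]⟩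

/-- The uplift region of `A = (α β; γ -α)`: the points `X + iY` of the upper half-plane with
`|(X - α/γ)² - Y²| < 1/γ²`. -/
def upliftRegion (A : SL(2, ℝ)) : Set ℍ :=
  {w | |(w.re - A 0 0 / A 1 0) ^ 2 - w.im ^ 2| < 1 / (A 1 0) ^ 2}

/-- The left half `X < α/γ` of the uplift region. -/
def upliftMinus (A : SL(2, ℝ)) : Set ℍ :=
  {w | w ∈ upliftRegion A ∧ w.re < A 0 0 / A 1 0}

/-- The rest of the uplift region. -/
def upliftPlus (A : SL(2, ℝ)) : Set ℍ :=
  {w | w ∈ upliftRegion A ∧ A 0 0 / A 1 0 ≤ w.re}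

/-- The intersection of a subset of the upper half-plane with the horizontal line `Y = h`,
described by the Euclidean coordinate `X` of the line. -/
def onLine (h : ℝ) (U : Set ℍ) : Set ℝ :=
  {X | ∃ w ∈ U, w.re = X ∧ w.im = h}

/-- The excision interval of `A` with respect to the translation length `a`: the intersection of
the line `Y = a/2` with the union of `U₊(A)` and `U₋(S^a A S^(-a))`. -/
def excisionInterval (a : ℝ) (A : SL(2, ℝ)) : Set ℝ :=
  onLine (a / 2) (upliftPlus A ∪ upliftMinus (S a * A * S (-a)))

/-- An ordered triple `(E, F, G)`. -/
structure Triple where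
  E : SL(2, ℝ)
  F : SL(2, ℝ)
  G : SL(2, ℝ)

/-- `ν : (E, F, G) ↦ (FEF, G, S^a F S^(-a))`. -/
def nu (a : ℝ) (t : Triple) : Triple := ⟨t.F * t.E * t.F, t.G, S a * t.F * S (-a)⟩

/-- `ρ : (E, F, G) ↦ (FGF, F, S^a E S^(-a))`. -/
def rho (a : ℝ) (t : Triple) : Triple := ⟨t.F * t.G * t.F, t.F, S a * t.E * S (-a)⟩

/-- `λ : (E, F, G) ↦ (EFE, E, G)`. -/
def lam (t : Triple) : Triple := ⟨t.E * t.F * t.E, t.E, t.G⟩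

/-- `Subtree a t₀ t`: the triple `t` is obtained from `t₀` by a finite (possibly empty) composition
of the moves `λ` and `ρ`. -/
inductive Subtree (a : ℝ) (t₀ : Triple) : Triple → Prop
  | root : Subtree a t₀ t₀
  | lam {t : Triple} : Subtree a t₀ t → Subtree a t₀ (lam t)
  | rho {t : Triple} : Subtree a t₀ t → Subtree a t₀ (rho a t)

namespace FrickeTriple

variable (f : FrickeTriple)

lemma a_pos : 0 < f.a := by linarith [f.two_lt_a]
lemma b_pos : 0 < f.b := by linarith [f.a_pos, f.a_le_b]
lemma c_pos : 0 < f.c := by linarith [f.b_pos, f.b_le_c]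

/-- The generator `T₀`. -/
def T₀ : SL(2, ℝ) :=
  ⟨!![0, -f.a / f.c; f.c / f.a, 0], by
    have := f.a_pos.ne'
    have := f.c_pos.ne'
    rw [Matrix.det_fin_two_of]
    field_simp
    ring⟩

/-- The generator `T₁`, whose upper right entry is the one forced by determinant one. -/
def T₁ : SL(2, ℝ) :=
  ⟨!![f.a / f.c, -(1 + (f.a / f.c) ^ 2) * (f.a / f.b); f.b / f.a, -(f.a / f.c)], by
    have := f.a_pos.ne'
    have := f.b_pos.ne'
    have := f.c_pos.ne'
    rw [Matrix.det_fin_two_of]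
    field_simp
    ring⟩

/-- The generator `T₂`, whose upper right entry is the one forced by determinant one. -/
def T₂ : SL(2, ℝ) :=
  ⟨!![f.a - f.b / f.c, -(1 + (f.a - f.b / f.c) ^ 2); 1, -f.a + f.b / f.c], by
    rw [Matrix.det_fin_two_of]
    ring⟩

/-- The initial triple `(T₀, T₁, T₂)`. -/
def initial : Triple := ⟨f.T₀, f.T₁, f.T₂⟩

/-- The nodes of the full tree: the `λ, ρ`-subtree of `(T₀, T₁, T₂)` joined to the
`λ, ρ`-subtree of `ν(T₀, T₁, T₂)`. -/
def IsNode (t : Triple) : Prop :=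
  Subtree f.a f.initial t ∨ Subtree f.a (nu f.a f.initial) t

/-- The order two elements appearing in the triple of some node of the tree. -/
def elements : Set SL(2, ℝ) :=
  {T | ∃ t : Triple, f.IsNode t ∧ (T = t.E ∨ T = t.F ∨ T = t.G)}

/-- The translate `S^(-a) T₂ S^a`, which takes the place of `T₂` in the normalized
configuration. -/
def T₂' : SL(2, ℝ) := S (-f.a) * f.T₂ * S f.a

/-- The indices of the excision intervals: the order two elements appearing in the tree, with `T₂`
replaced by its translate `S^(-a) T₂ S^a`. -/
def indexSet : Set SL(2, ℝ) := insert f.T₂' (f.elements \ {f.T₂})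

/-- The ambient interval on `Y = a/2`: from the left endpoint of the intersection of the line with
`U₊(S^(-a) T₂ S^a)` to the left endpoint of its intersection with `U₊(T₂)`. -/
def ambientInterval : Set ℝ :=
  Set.Icc (sInf (onLine (f.a / 2) (upliftPlus f.T₂'))) (sInf (onLine (f.a / 2) (upliftPlus f.T₂)))

/-- The complement, in the ambient interval, of the union of the excision intervals. -/
def residualSet : Set ℝ :=
  f.ambientInterval \ ⋃ T ∈ f.indexSet, excisionInterval f.a T

end FrickeTriple

end Uplift

end

/-! The excision intervals of $T_2'$, $T_0$, $T_1$ leave three gaps in the ambient interval, apart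
from its left endpoint. Each gap is the root of a binary tree: the interval of `E` at a node splits
the gap between the intervals of `G` (shifted by $-a$) and of `F` into the gaps of the `lam`-child
and of the `rho`-child.

Writing $x,y,z$ for the Markov numbers of `E`, `F`, `G`, the gap at a node has length at most a
constant times $(2/y)(2/z)$ (`IsReduced.gap_length_le`). The hypothesis $c<ab/2$ gives $x\ge\kappa
yz$ with a fixed $\kappa>1/2$ throughout the tree, so $2/x\le(2/y)(2/z)$. Each move therefore keeps
one weight and replaces the other by at most the product.

Under exact multiplication the products of weights along the tree are $u^jv^k$ for coprime
$j,k\ge1$, each occurring once, so their sum is at most $\sum_{j,k\ge1}u^jv^k<\infty$. The rule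
survives taking $s$-th powers, so the $s$-dimensional Hausdorff measure is finite for every $s>0$,
and the dimension is zero (`WeightedTree.dimH_eq_zero`). -/

noncomputable section

namespace Uplift

/-! ### Binary trees with multiplicative weights, and Hausdorff dimension -/

section BinaryTree

open Filter Topology

/-- The generating function `∑ x ^ j * y ^ k` over positive exponents. -/
def pairSeries (x y : ℝ) : ℝ := x * y / ((1 - x) * (1 - y))

lemma pairSeries_nonneg {x y : ℝ} (hx : 0 ≤ x) (hx1 : x < 1) (hy : 0 ≤ y) (hy1 : y < 1) :
    0 ≤ pairSeries x y := by
  have : 0 < 1 - x := by linarith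
  have : 0 < 1 - y := by linarith
  unfold pairSeries
  positivity

lemma pairSeries_mono {x y x' y' : ℝ} (hx : 0 ≤ x) (hxx : x ≤ x') (hx1 : x' < 1)
    (hy : 0 ≤ y) (hyy : y ≤ y') (hy1 : y' < 1) : pairSeries x y ≤ pairSeries x' y' := by
  have h1 : 0 < 1 - x' := by linarith
  have h2 : 0 < 1 - y' := by linarith
  unfold pairSeries
  apply div_le_div₀
  · exact mul_nonneg (hx.trans hxx) (hy.trans hyy)
  · exact mul_le_mul hxx hyy hy (hx.trans hxx)
  · positivity
  · exact mul_le_mul (by linarith) (by linarith) h2.le (by linarith)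

/-- Sort the pairs of exponents $(j,k)$ by $j=k$, $j<k$, $j>k$, as in the Euclidean algorithm. The
two off-diagonal parts are the series of the two children; of the diagonal only its first term is
kept. -/
lemma pairSeries_split {x y : ℝ} (hx : 0 ≤ x) (hx1 : x < 1) (hy : 0 ≤ y) (hy1 : y < 1) :
    x * y + (pairSeries (x * y) y + pairSeries x (x * y)) ≤ pairSeries x y := by
  have h1 : 0 < 1 - x := by linarith
  have h2 : 0 < 1 - y := by linarith
  have hxy : x * y < 1 := by nlinarith
  have h3 : 0 < 1 - x * y := by linarith
  have key : pairSeries x y = x * y / (1 - x * y) +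
      (pairSeries (x * y) y + pairSeries x (x * y)) := by
    unfold pairSeries
    field_simp
    ring
  rw [key]
  have : x * y ≤ x * y / (1 - x * y) := by
    rw [le_div_iff₀ h3]
    nlinarith [mul_nonneg hx hy]
  linarith

variable {τ : Type*}

/-- The nodes at depth `n` below `t` in the binary tree generated by two moves. -/
def levelList (L R : τ → τ) : ℕ → τ → List τ
  | 0, t => [t]
  | n + 1, t => levelList L R n (L t) ++ levelList L R n (R t)

/-- A weighted binary tree: two weights in `(0, 1)` at each node, where each move keeps one
weight and replaces the other by at most the product. -/
structure WeightedTree (L R : τ → τ) (P : τ → Prop) (u v : τ → ℝ) : Prop where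
  left_mem : ∀ t, P t → P (L t)
  right_mem : ∀ t, P t → P (R t)
  u_pos : ∀ t, P t → 0 < u t
  u_lt : ∀ t, P t → u t < 1
  v_pos : ∀ t, P t → 0 < v t
  v_lt : ∀ t, P t → v t < 1
  u_left : ∀ t, P t → u (L t) ≤ u t * v t
  v_left : ∀ t, P t → v (L t) ≤ v t
  u_right : ∀ t, P t → u (R t) ≤ u t
  v_right : ∀ t, P t → v (R t) ≤ u t * v t

variable {L R : τ → τ} {P : τ → Prop} {u v : τ → ℝ}

lemma WeightedTree.levelList_mem (h : WeightedTree L R P u v) (n : ℕ) {t : τ} (ht : P t) :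
    ∀ t' ∈ levelList L R n t, P t' := by
  induction n generalizing t with
  | zero => simpa [levelList] using ht
  | succ n ih =>
    intro t' h'
    rcases List.mem_append.1 h' with h' | h'
    · exact ih (h.left_mem t ht) t' h'
    · exact ih (h.right_mem t ht) t' h'

/-- Powers preserve both $(0,1)$ and products. This is what makes one summability bound serve every
exponent $s>0$. -/
lemma WeightedTree.rpow (h : WeightedTree L R P u v) {s : ℝ} (hs : 0 < s) :
    WeightedTree L R P (fun t => u t ^ s) (fun t => v t ^ s) where
  left_mem := h.left_mem
  right_mem := h.right_mem
  u_pos t ht := Real.rpow_pos_of_pos (h.u_pos t ht) s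
  u_lt t ht := Real.rpow_lt_one (h.u_pos t ht).le (h.u_lt t ht) hs
  v_pos t ht := Real.rpow_pos_of_pos (h.v_pos t ht) s
  v_lt t ht := Real.rpow_lt_one (h.v_pos t ht).le (h.v_lt t ht) hs
  u_left t ht := by
    rw [← Real.mul_rpow (h.u_pos t ht).le (h.v_pos t ht).le]
    exact Real.rpow_le_rpow (h.u_pos _ (h.left_mem t ht)).le (h.u_left t ht) hs.le
  v_left t ht := Real.rpow_le_rpow (h.v_pos _ (h.left_mem t ht)).le (h.v_left t ht) hs.le
  u_right t ht := Real.rpow_le_rpow (h.u_pos _ (h.right_mem t ht)).le (h.u_right t ht) hs.le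
  v_right t ht := by
    rw [← Real.mul_rpow (h.u_pos t ht).le (h.v_pos t ht).le]
    exact Real.rpow_le_rpow (h.v_pos _ (h.right_mem t ht)).le (h.v_right t ht) hs.le

/-- The total weight of the nodes at depth `n`. -/
def levelSum (L R : τ → τ) (u v : τ → ℝ) (n : ℕ) (t : τ) : ℝ :=
  ((levelList L R n t).map fun t => u t * v t).sum

lemma WeightedTree.levelSum_nonneg (h : WeightedTree L R P u v) (n : ℕ) {t : τ} (ht : P t) :
    0 ≤ levelSum L R u v n t := by
  refine List.sum_nonneg fun x hx => ?_
  obtain ⟨t', ht', rfl⟩ := List.mem_map.1 hx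
  have := h.levelList_mem n ht t' ht'
  exact mul_nonneg (h.u_pos _ this).le (h.v_pos _ this).le

lemma WeightedTree.sum_levelSum_le (h : WeightedTree L R P u v) (n : ℕ) {t : τ} (ht : P t) :
    ∑ i ∈ Finset.range n, levelSum L R u v i t ≤ pairSeries (u t) (v t) := by
  induction n generalizing t with
  | zero =>
    simpa using pairSeries_nonneg (h.u_pos t ht).le (h.u_lt t ht) (h.v_pos t ht).le (h.v_lt t ht)
  | succ n ih =>
    have hl := h.left_mem t ht
    have hr := h.right_mem t ht
    have hu := (h.u_pos t ht).le
    have hv := (h.v_pos t ht).le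
    have huv : u t * v t < 1 := by nlinarith [h.u_lt t ht, h.v_lt t ht]
    rw [Finset.sum_range_succ']
    have e : ∀ i, levelSum L R u v (i + 1) t =
        levelSum L R u v i (L t) + levelSum L R u v i (R t) := by
      intro i
      simp [levelSum, levelList]
    simp only [e, Finset.sum_add_distrib]
    have e0 : levelSum L R u v 0 t = u t * v t := by simp [levelSum, levelList]
    have hL := (ih hl).trans (pairSeries_mono (h.u_pos _ hl).le (h.u_left t ht) huv
      (h.v_pos _ hl).le (h.v_left t ht) (h.v_lt t ht))
    have hR := (ih hr).trans (pairSeries_mono (h.u_pos _ hr).le (h.u_right t ht) (h.u_lt t ht)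
      (h.v_pos _ hr).le (h.v_right t ht) huv)
    linarith [pairSeries_split hu (h.u_lt t ht) hv (h.v_lt t ht)]

/-- The level sums are the terms of a convergent series. Only this decay is needed to make the mesh
of the covers shrink. -/
lemma WeightedTree.tendsto_levelSum (h : WeightedTree L R P u v) {t : τ} (ht : P t) :
    Tendsto (fun n => levelSum L R u v n t) atTop (𝓝 0) :=
  (summable_of_sum_range_le (fun n => h.levelSum_nonneg n ht)
    (fun n => h.sum_levelSum_le n ht)).tendsto_atTop_zero

lemma WeightedTree.levelSum_le (h : WeightedTree L R P u v) (n : ℕ) {t : τ} (ht : P t) :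
    levelSum L R u v n t ≤ pairSeries (u t) (v t) :=
  (Finset.single_le_sum (f := fun i => levelSum L R u v i t)
    (fun i _ => h.levelSum_nonneg i ht) (Finset.self_mem_range_succ n)).trans
    (h.sum_levelSum_le (n + 1) ht)

/-- A set covered at every depth by intervals whose lengths are bounded by the products of the
weights of a weighted tree has Hausdorff dimension zero. -/
theorem WeightedTree.dimH_eq_zero (h : WeightedTree L R P u v) {t : τ} (ht : P t)
    (lo hi : τ → ℝ) {C : ℝ} (hC : 0 ≤ C) (hlen : ∀ t, P t → hi t - lo t ≤ C * (u t * v t))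
    {A : Set ℝ} (hA : ∀ n, ∀ x ∈ A, ∃ t' ∈ levelList L R n t, x ∈ Set.Icc (lo t') (hi t')) :
    dimH A = 0 := by
  have bound : ∀ s : NNReal, 0 < s → dimH A ≤ s := by
    intro s hs
    have hs' : (0 : ℝ) < s := hs
    apply dimH_le_of_hausdorffMeasure_ne_top
    have hw := h.rpow hs'
    have hdiam : ∀ n (i : Fin (levelList L R n t).length),
        Metric.ediam (Set.Icc (lo ((levelList L R n t)[i])) (hi ((levelList L R n t)[i]))) ≤
        ENNReal.ofReal (C * (u ((levelList L R n t)[i]) * v ((levelList L R n t)[i]))) := by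
      intro n i
      rw [Real.ediam_Icc]
      exact ENNReal.ofReal_le_ofReal (hlen _ (h.levelList_mem n ht _ (List.getElem_mem _)))
    have hsum : ∀ (f : τ → ℝ) n, ∑ i : Fin (levelList L R n t).length,
        f ((levelList L R n t)[i]) = ((levelList L R n t).map f).sum := by
      intro f n
      exact Fin.sum_univ_fun_getElem _ _
    have key := Measure.hausdorffMeasure_le_liminf_sum (ι := fun n => Fin (levelList L R n t).length)
      (s : ℝ) A (l := atTop) (fun n => ENNReal.ofReal (C * levelSum L R u v n t))
      (by
        have := ENNReal.tendsto_ofReal ((h.tendsto_levelSum ht).const_mul C)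
        simpa using this)
      (fun n i => Set.Icc (lo ((levelList L R n t)[i])) (hi ((levelList L R n t)[i])))
      (Eventually.of_forall fun n i => (hdiam n i).trans (ENNReal.ofReal_le_ofReal (by
        refine mul_le_mul_of_nonneg_left ?_ hC
        unfold levelSum
        rw [← hsum (fun t => u t * v t) n]
        refine Finset.single_le_sum (f := fun i : Fin (levelList L R n t).length =>
          u ((levelList L R n t)[i]) * v ((levelList L R n t)[i])) (fun j _ => ?_)
          (Finset.mem_univ i)
        have := h.levelList_mem n ht _ (List.getElem_mem j.2)
        exact mul_nonneg (h.u_pos _ this).le (h.v_pos _ this).le)))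
      (Eventually.of_forall fun n x hx => by
        obtain ⟨t', ht', hx'⟩ := hA n x hx
        obtain ⟨i, hi', rfl⟩ := List.getElem_of_mem ht'
        exact Set.mem_iUnion.2 ⟨⟨i, hi'⟩, hx'⟩)
    refine ne_top_of_le_ne_top (ENNReal.ofReal_ne_top
      (r := C ^ (s : ℝ) * pairSeries (u t ^ (s : ℝ)) (v t ^ (s : ℝ)))) (key.trans ?_)
    refine (liminf_le_liminf (v := fun _ => ENNReal.ofReal
      (C ^ (s : ℝ) * pairSeries (u t ^ (s : ℝ)) (v t ^ (s : ℝ))))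
      (Eventually.of_forall fun n => ?_)).trans (by simp)
    have hterm : ∀ i : Fin (levelList L R n t).length,
        Metric.ediam (Set.Icc (lo ((levelList L R n t)[i])) (hi ((levelList L R n t)[i]))) ^ (s : ℝ)
        ≤ ENNReal.ofReal (C ^ (s : ℝ) * (u ((levelList L R n t)[i]) ^ (s : ℝ) *
          v ((levelList L R n t)[i]) ^ (s : ℝ))) := by
      intro i
      have := h.levelList_mem n ht _ (List.getElem_mem i.2)
      have h1 : 0 ≤ u ((levelList L R n t)[i]) := (h.u_pos _ this).le
      have h2 : 0 ≤ v ((levelList L R n t)[i]) := (h.v_pos _ this).le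
      refine (ENNReal.rpow_le_rpow (hdiam n i) hs'.le).trans ?_
      rw [ENNReal.ofReal_rpow_of_nonneg (mul_nonneg hC (mul_nonneg h1 h2)) hs'.le,
        Real.mul_rpow hC (mul_nonneg h1 h2), Real.mul_rpow h1 h2]
    refine (Finset.sum_le_sum fun i _ => hterm i).trans ?_
    rw [← ENNReal.ofReal_sum_of_nonneg]
    · refine ENNReal.ofReal_le_ofReal ?_
      rw [← Finset.mul_sum, hsum (fun t => u t ^ (s : ℝ) * v t ^ (s : ℝ)) n]
      exact mul_le_mul_of_nonneg_left (hw.levelSum_le n ht) (Real.rpow_nonneg hC _)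
    · intro i _
      have := h.levelList_mem n ht _ (List.getElem_mem i.2)
      exact mul_nonneg (Real.rpow_nonneg hC _)
        (mul_nonneg (hw.u_pos _ this).le (hw.v_pos _ this).le)
  by_contra hne
  obtain ⟨s, hs, hs'⟩ := ENNReal.lt_iff_exists_nnreal_btwn.1 (pos_iff_ne_zero.2 hne)
  exact absurd (bound s (by exact_mod_cast hs)) (not_le.2 hs')

end BinaryTree

/-! ### Elliptic elements: fixed points, Markov numbers, conjugation -/

/-- Trace zero with nonzero lower left entry. -/
def IsElliptic (A : SL(2, ℝ)) : Prop := A 1 1 = -A 0 0 ∧ A 1 0 ≠ 0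

/-- The real part of the fixed point. -/
def axis (A : SL(2, ℝ)) : ℝ := A 0 0 / A 1 0

/-- The generalized Markov number of an elliptic element. -/
def number (a : ℝ) (A : SL(2, ℝ)) : ℝ := a * |A 1 0|

lemma number_pos {a : ℝ} (ha : 0 < a) {A : SL(2, ℝ)} (hA : IsElliptic A) : 0 < number a A :=
  mul_pos ha (abs_pos.2 hA.2)

lemma upper_right_eq {A : SL(2, ℝ)} (hA : IsElliptic A) : A 0 1 = -(1 + A 0 0 ^ 2) / A 1 0 := by
  have h := A.det_coe
  rw [Matrix.det_fin_two, hA.1] at h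
  rw [eq_div_iff hA.2]
  linarith

lemma translate_entries (a : ℝ) (A : SL(2, ℝ)) :
    (S a * A * S (-a)) 1 0 = A 1 0 ∧ (S a * A * S (-a)) 0 0 = A 0 0 + a * A 1 0 ∧
    (S a * A * S (-a)) 1 1 = A 1 1 - a * A 1 0 := by
  have h (t : ℝ) : (S t : Matrix (Fin 2) (Fin 2) ℝ) = !![1, t; 0, 1] := rfl
  simp only [Matrix.SpecialLinearGroup.coe_mul, Matrix.mul_apply, Fin.sum_univ_two, h]
  exact ⟨by simp, by simp, by simp; ring⟩

lemma isElliptic_translate (a : ℝ) {A : SL(2, ℝ)} (hA : IsElliptic A) :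
    IsElliptic (S a * A * S (-a)) := by
  obtain ⟨h1, h2, h3⟩ := translate_entries a A
  refine ⟨?_, by rw [h1]; exact hA.2⟩
  rw [h3, h2, hA.1]
  ring

lemma axis_translate (a : ℝ) {A : SL(2, ℝ)} (hA : IsElliptic A) :
    axis (S a * A * S (-a)) = axis A + a := by
  obtain ⟨h1, h2, h3⟩ := translate_entries a A
  have := hA.2
  unfold axis
  rw [h1, h2]
  field_simp

lemma number_translate (a t : ℝ) (A : SL(2, ℝ)) : number a (S t * A * S (-t)) = number a A := by
  unfold number
  rw [(translate_entries t A).1]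

lemma conj_entries {F G : SL(2, ℝ)} (hF : IsElliptic F) (hG : IsElliptic G) :
    (F * G * F) 1 0 = -(F 1 0 ^ 2 * G 1 0 * ((axis G - axis F) ^ 2 + 1 / G 1 0 ^ 2)) ∧
    (F * G * F) 0 0 = axis F * (F * G * F) 1 0 + G 1 0 * (axis G - axis F) ∧
    (F * G * F) 1 1 = -(F * G * F) 0 0 := by
  have h1 := upper_right_eq hF
  have h2 := upper_right_eq hG
  have h3 := hF.2
  have h4 := hG.2
  simp only [axis, Matrix.SpecialLinearGroup.coe_mul, Matrix.mul_apply, Fin.sum_univ_two, h1, h2,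
    hF.1, hG.1]
  refine ⟨?_, ?_, ?_⟩
  · field_simp
    ring
  · field_simp
    ring
  · field_simp
    ring

lemma isElliptic_conj {F G : SL(2, ℝ)} (hF : IsElliptic F) (hG : IsElliptic G) :
    IsElliptic (F * G * F) := by
  obtain ⟨h1, h2, h3⟩ := conj_entries hF hG
  refine ⟨h3, ?_⟩
  rw [h1]
  have h4 := hG.2
  have : 0 < (axis G - axis F) ^ 2 + 1 / G 1 0 ^ 2 := by positivity
  simp only [ne_eq, neg_eq_zero, mul_eq_zero, not_or]
  exact ⟨⟨pow_ne_zero 2 hF.2, h4⟩, this.ne'⟩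

lemma axis_conj {a : ℝ} (ha : 0 < a) {F G : SL(2, ℝ)} (hF : IsElliptic F) (hG : IsElliptic G) :
    axis (F * G * F) = axis F - (axis G - axis F) * number a G / number a (F * G * F) := by
  obtain ⟨h1, h2, h3⟩ := conj_entries hF hG
  have h0 := (isElliptic_conj hF hG).2
  have hpos : 0 < (axis G - axis F) ^ 2 + 1 / G 1 0 ^ 2 := by
    have := hG.2
    positivity
  have hF2 := hF.2
  have hG2 := hG.2
  have e : axis (F * G * F) = axis F + G 1 0 * (axis G - axis F) / (F * G * F) 1 0 := by
    rw [axis, h2]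
    field_simp
  rw [e, number, number, h1, abs_neg, abs_mul, abs_mul, abs_of_pos hpos,
    abs_of_nonneg (sq_nonneg (F 1 0))]
  generalize (axis G - axis F) ^ 2 + 1 / G 1 0 ^ 2 = q at hpos
  have := abs_pos.2 hG2
  field_simp
  ring

/-- The parameter `p` is the Markov number of the third element of a configuration; the spacing
hypothesis turns the conjugation formula into a Vieta jump. -/
lemma number_conj {a p : ℝ} (ha : 0 < a) {F G : SL(2, ℝ)} (hF : IsElliptic F) (hG : IsElliptic G)
    (hD : (axis G - axis F) ^ 2 = (a * p / (number a F * number a G)) ^ 2) :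
    number a (F * G * F) = (p ^ 2 + number a F ^ 2) / number a G := by
  obtain ⟨h1, -, -⟩ := conj_entries hF hG
  have hpos : 0 < (axis G - axis F) ^ 2 + 1 / G 1 0 ^ 2 := by
    have := hG.2
    positivity
  rw [number, h1, abs_neg, abs_mul, abs_mul, abs_of_pos hpos, abs_of_nonneg (sq_nonneg (F 1 0)), hD]
  unfold number
  rw [← sq_abs (F 1 0), ← sq_abs (G 1 0)]
  have := abs_pos.2 hF.2
  have := abs_pos.2 hG.2
  field_simp

/-! ### Configurations and their invariance under the moves -/

/-- Triples of elliptic elements whose consecutive fixed points, up to the translation by `a`,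
have the spacing prescribed by their Markov numbers. -/
structure IsConfig (a : ℝ) (t : Triple) : Prop where
  ellE : IsElliptic t.E
  ellF : IsElliptic t.F
  ellG : IsElliptic t.G
  gapEF : axis t.F - axis t.E = a * number a t.G / (number a t.E * number a t.F)
  gapFG : axis t.G - axis t.F = a * number a t.E / (number a t.F * number a t.G)
  gapGE : axis t.E + a - axis t.G = a * number a t.F / (number a t.G * number a t.E)

namespace IsConfig

variable {a : ℝ} {t : Triple}

/-- The three spacings close up to one period $a$; clearing denominators in that sum gives the
equation. -/
lemma markov (h : IsConfig a t) (ha : 0 < a) :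
    number a t.E ^ 2 + number a t.F ^ 2 + number a t.G ^ 2 =
      number a t.E * number a t.F * number a t.G := by
  have h1 := number_pos ha h.ellE
  have h2 := number_pos ha h.ellF
  have h3 := number_pos ha h.ellG
  have e : a = a * number a t.G / (number a t.E * number a t.F) +
      a * number a t.E / (number a t.F * number a t.G) +
      a * number a t.F / (number a t.G * number a t.E) := by
    rw [← h.gapEF, ← h.gapFG, ← h.gapGE]
    ring
  generalize number a t.E = x at *
  generalize number a t.F = y at *
  generalize number a t.G = z at *
  field_simp at e
  linarith

/-- Cyclic symmetry modulo the translation; `rho` is `lam` applied after this rotation. -/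
lemma rotate (h : IsConfig a t) : IsConfig a ⟨t.F, t.G, S a * t.E * S (-a)⟩ where
  ellE := h.ellF
  ellF := h.ellG
  ellG := isElliptic_translate a h.ellE
  gapEF := by simpa only [number_translate] using h.gapFG
  gapFG := by simpa only [number_translate, axis_translate a h.ellE] using h.gapGE
  gapGE := by
    simp only [number_translate, axis_translate a h.ellE]
    rw [← h.gapEF]
    ring

lemma number_lam (h : IsConfig a t) (ha : 0 < a) :
    number a (t.E * t.F * t.E) = number a t.E * number a t.G - number a t.F := by
  rw [number_conj ha h.ellE h.ellF (by rw [h.gapEF]), div_eq_iff (number_pos ha h.ellF).ne']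
  linarith [h.markov ha]

lemma lam (h : IsConfig a t) (ha : 0 < a) : IsConfig a (lam t) := by
  have hE' := isElliptic_conj h.ellE h.ellF
  have h1 := number_pos ha h.ellE
  have h2 := number_pos ha h.ellF
  have h3 := number_pos ha h.ellG
  have h4 := number_pos ha hE'
  have hn := h.number_lam ha
  have hm := h.markov ha
  have hx := axis_conj ha h.ellE h.ellF
  rw [h.gapEF] at hx
  have hg := h.gapGE
  refine ⟨hE', h.ellE, h.ellG, ?_, ?_, ?_⟩ <;> simp only [Uplift.lam]
  · rw [hx]
    field_simp
    ring
  · rw [hn, mul_sub, sub_div, ← mul_comm (number a t.G), ← hg, mul_comm (number a t.G),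
      mul_div_assoc, div_self (by positivity)]
    ring
  · have e : axis (t.E * t.F * t.E) + a - axis t.G = a * number a t.F / (number a t.G * number a t.E)
        - a * number a t.G / (number a t.E * number a t.F) * number a t.F /
          number a (t.E * t.F * t.E) := by
      rw [hx, ← hg]
      ring
    rw [e]
    field_simp
    rw [hn]
    linarith

lemma rho (h : IsConfig a t) (ha : 0 < a) : IsConfig a (rho a t) := h.rotate.lam ha

lemma number_rho (h : IsConfig a t) (ha : 0 < a) :
    number a (t.F * t.G * t.F) = number a t.E * number a t.F - number a t.G := by
  rw [h.rotate.number_lam ha, number_translate]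
  ring

lemma number_nu (h : IsConfig a t) (ha : 0 < a) :
    number a (t.F * t.E * t.F) = number a t.F * number a t.G - number a t.E := by
  rw [number_conj (p := number a t.G) ha h.ellF h.ellE
    (by rw [← neg_sub, h.gapEF, mul_comm (number a t.F)]; ring),
    div_eq_iff (number_pos ha h.ellE).ne']
  linarith [h.markov ha]

lemma nu (h : IsConfig a t) (ha : 0 < a) : IsConfig a (nu a t) := by
  have hE' := isElliptic_conj h.ellF h.ellE
  have h1 := number_pos ha h.ellE
  have h2 := number_pos ha h.ellF
  have h3 := number_pos ha h.ellG
  have h4 := number_pos ha hE'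
  have hn := h.number_nu ha
  have hm := h.markov ha
  have hx := axis_conj ha h.ellF h.ellE
  rw [← neg_sub (axis t.F), h.gapEF] at hx
  have hg := h.gapFG
  refine ⟨hE', h.ellG, isElliptic_translate a h.ellF, ?_, ?_, ?_⟩ <;>
    simp only [Uplift.nu, number_translate, axis_translate a h.ellF]
  · have e : axis t.G - axis (t.F * t.E * t.F) = a * number a t.E / (number a t.F * number a t.G)
        - a * number a t.G / (number a t.E * number a t.F) * number a t.E /
          number a (t.F * t.E * t.F) := by
      rw [hx, ← hg]
      ring
    rw [e]
    field_simp
    rw [hn]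
    linarith
  · rw [hn, mul_sub, sub_div, mul_comm (number a t.G), ← hg, mul_div_assoc,
      div_self (by positivity)]
    ring
  · rw [hx]
    field_simp
    ring

lemma axis_E_lt_F (h : IsConfig a t) (ha : 0 < a) : axis t.E < axis t.F := by
  have h1 := number_pos ha h.ellE
  have h2 := number_pos ha h.ellF
  have h3 := number_pos ha h.ellG
  rw [← sub_pos, h.gapEF]
  positivity

end IsConfig

/-! ### Excision intervals in coordinates -/

lemma mem_onLine_upliftPlus {h : ℝ} (hh : 0 < h) {A : SL(2, ℝ)} {X : ℝ} :
    X ∈ onLine h (upliftPlus A) ↔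
      |(X - axis A) ^ 2 - h ^ 2| < 1 / A 1 0 ^ 2 ∧ axis A ≤ X := by
  constructor
  · rintro ⟨w, hw, rfl, rfl⟩
    exact hw
  · intro hX
    exact ⟨⟨⟨X, h⟩, hh⟩, hX, rfl, rfl⟩

lemma mem_onLine_upliftMinus {h : ℝ} (hh : 0 < h) {A : SL(2, ℝ)} {X : ℝ} :
    X ∈ onLine h (upliftMinus A) ↔
      |(X - axis A) ^ 2 - h ^ 2| < 1 / A 1 0 ^ 2 ∧ X < axis A := by
  constructor
  · rintro ⟨w, hw, rfl, rfl⟩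
    exact hw
  · intro hX
    exact ⟨⟨⟨X, h⟩, hh⟩, hX, rfl, rfl⟩

lemma mem_onLine_union {h : ℝ} {U V : Set ℍ} {X : ℝ} :
    X ∈ onLine h (U ∪ V) ↔ X ∈ onLine h U ∨ X ∈ onLine h V := by
  constructor
  · rintro ⟨w, hw | hw, h1, h2⟩
    · exact Or.inl ⟨w, hw, h1, h2⟩
    · exact Or.inr ⟨w, hw, h1, h2⟩
  · rintro (⟨w, hw, h1, h2⟩ | ⟨w, hw, h1, h2⟩)
    · exact ⟨w, Or.inl hw, h1, h2⟩
    · exact ⟨w, Or.inr hw, h1, h2⟩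

/-- The distance from the fixed point of `A` to the left endpoint of its excision interval. -/
def offset (a : ℝ) (A : SL(2, ℝ)) : ℝ := √((a / 2) ^ 2 - 1 / A 1 0 ^ 2)

/-- The left endpoint of the excision interval. -/
def leftEnd (a : ℝ) (A : SL(2, ℝ)) : ℝ := axis A + offset a A

/-- The right endpoint of the excision interval. -/
def rightEnd (a : ℝ) (A : SL(2, ℝ)) : ℝ := axis A + a - offset a A

lemma rightEnd_translate (a : ℝ) {A : SL(2, ℝ)} (hA : IsElliptic A) :
    rightEnd a (S a * A * S (-a)) = rightEnd a A + a := by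
  simp only [rightEnd, offset, axis_translate a hA, (translate_entries a A).1]
  ring

lemma inv_lower_sq_eq {a : ℝ} (ha : 0 < a) {A : SL(2, ℝ)} (hA : IsElliptic A) :
    1 / A 1 0 ^ 2 = a ^ 2 / number a A ^ 2 := by
  have := abs_pos.2 hA.2
  rw [number, ← sq_abs]
  field_simp

lemma inv_lower_sq_lt {a : ℝ} (ha : 0 < a) {A : SL(2, ℝ)} (hA : IsElliptic A)
    (hm : 2 < number a A) : 1 / A 1 0 ^ 2 < (a / 2) ^ 2 := by
  rw [inv_lower_sq_eq ha hA, div_pow, div_lt_div_iff_of_pos_left (by positivity) (by positivity)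
    (by norm_num)]
  nlinarith

lemma offset_sq {a : ℝ} (ha : 0 < a) {A : SL(2, ℝ)} (hA : IsElliptic A)
    (hm : 2 < number a A) : offset a A ^ 2 = (a / 2) ^ 2 - 1 / A 1 0 ^ 2 :=
  Real.sq_sqrt (sub_nonneg.2 (inv_lower_sq_lt ha hA hm).le)

lemma offset_nonneg (a : ℝ) (A : SL(2, ℝ)) : 0 ≤ offset a A := Real.sqrt_nonneg _

lemma offset_lt {a : ℝ} (ha : 0 < a) {A : SL(2, ℝ)} (hA : IsElliptic A)
    (hm : 2 < number a A) : offset a A < a / 2 := by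
  have h := offset_sq ha hA hm
  have : 0 < 1 / A 1 0 ^ 2 := by
    have := hA.2
    positivity
  exact lt_of_pow_lt_pow_left₀ 2 (by positivity) (by linarith)

lemma Ioo_subset_excisionInterval {a : ℝ} (ha : 0 < a) {A : SL(2, ℝ)} (hA : IsElliptic A)
    (hm : 2 < number a A) : Set.Ioo (leftEnd a A) (rightEnd a A) ⊆ excisionInterval a A := by
  rintro X ⟨h1, h2⟩
  have hs := offset_sq ha hA hm
  have h0 := offset_nonneg a A
  have he : 0 < 1 / A 1 0 ^ 2 := by
    have := hA.2
    positivity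
  unfold leftEnd at h1
  unfold rightEnd at h2
  unfold excisionInterval
  rw [mem_onLine_union]
  -- The midpoint `axis A + a / 2` lies in both halves, since there the squared distance to either
  -- center is exactly $(a/2)^2$; so the two pieces overlap and cover the interval.
  rcases le_or_gt X (axis A + a / 2) with h | h
  · left
    rw [mem_onLine_upliftPlus (by positivity)]
    refine ⟨?_, by linarith⟩
    rw [abs_lt]
    constructor
    · nlinarith
    · nlinarith
  · right
    rw [mem_onLine_upliftMinus (by positivity), axis_translate a hA, (translate_entries a A).1]
    refine ⟨?_, by linarith⟩
    rw [abs_lt]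
    constructor
    · nlinarith
    · nlinarith

lemma sInf_onLine_upliftPlus {a : ℝ} (ha : 0 < a) {A : SL(2, ℝ)} (hA : IsElliptic A)
    (hm : 2 < number a A) : sInf (onLine (a / 2) (upliftPlus A)) = leftEnd a A := by
  have he : 0 < 1 / A 1 0 ^ 2 := by
    have := hA.2
    positivity
  have h0 := offset_nonneg a A
  have hs := offset_sq ha hA hm
  have hT : √((a / 2) ^ 2 + 1 / A 1 0 ^ 2) ^ 2 = (a / 2) ^ 2 + 1 / A 1 0 ^ 2 :=
    Real.sq_sqrt (by positivity)
  have hT0 := Real.sqrt_nonneg ((a / 2) ^ 2 + 1 / A 1 0 ^ 2)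
  have hlt : offset a A < √((a / 2) ^ 2 + 1 / A 1 0 ^ 2) :=
    lt_of_pow_lt_pow_left₀ 2 hT0 (by linarith)
  have e : onLine (a / 2) (upliftPlus A) =
      Set.Ioo (leftEnd a A) (axis A + √((a / 2) ^ 2 + 1 / A 1 0 ^ 2)) := by
    ext X
    rw [mem_onLine_upliftPlus (by positivity), leftEnd, Set.mem_Ioo, abs_lt]
    constructor
    · rintro ⟨⟨h1, h2⟩, h3⟩
      constructor
      · have := lt_of_pow_lt_pow_left₀ 2 (sub_nonneg.2 h3)
          (show offset a A ^ 2 < (X - axis A) ^ 2 by linarith)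
        linarith
      · have := lt_of_pow_lt_pow_left₀ 2 hT0
          (show (X - axis A) ^ 2 < √((a / 2) ^ 2 + 1 / A 1 0 ^ 2) ^ 2 by linarith)
        linarith
    · rintro ⟨h1, h2⟩
      have h3 : (offset a A) ^ 2 < (X - axis A) ^ 2 :=
        pow_lt_pow_left₀ (by linarith) h0 two_ne_zero
      have h4 : (X - axis A) ^ 2 < √((a / 2) ^ 2 + 1 / A 1 0 ^ 2) ^ 2 :=
        pow_lt_pow_left₀ (by linarith) (by linarith) two_ne_zero
      exact ⟨⟨by linarith, by linarith⟩, by linarith⟩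
  rw [e, csInf_Ioo]
  unfold leftEnd
  linarith

/-! ### Gap lengths in reduced configurations -/

/-- If `D (a - D) = r (a - r) + r' (a - r')`, then `D` exceeds `r + r'` by at most a multiple of
`r r'`. -/
lemma sub_sub_le_of_mul_sub_eq {a D r r' κ : ℝ} (ha : 0 < a) (hκ : 1 / 2 < κ) (hr : 0 ≤ r)
    (hr' : 0 ≤ r') (hrr : r ≤ a / 2) (hrr' : r' ≤ a / 2) (hD : D ≤ (1 - κ) * a)
    (h : D * (a - D) = r * (a - r) + r' * (a - r')) :
    D - r - r' ≤ 2 * r * r' / (a * (2 * κ - 1)) := by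
  have hpos : 0 < a * (2 * κ - 1) := mul_pos ha (by linarith)
  have hD2 : 2 * D < a := by nlinarith
  have h1 : r ≤ D := by
    by_contra! hc
    nlinarith [mul_nonneg hr' (show 0 ≤ a - r' by linarith)]
  -- As for `r`: the function $x(a-x)$ increases on $[0,a/2]$.
  have h2 : r' ≤ D := by
    by_contra! hc
    nlinarith [mul_nonneg hr (show 0 ≤ a - r by linarith)]
  have h3 : r + r' ≤ D := by
    by_contra! hc
    nlinarith [mul_nonneg hr (sub_nonneg.2 h1), mul_nonneg hr' (sub_nonneg.2 h2)]
  have e : (D - r - r') * (a - D - r - r') = 2 * r * r' := by linarith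
  rw [le_div_iff₀ hpos, ← e]
  exact mul_le_mul_of_nonneg_left (by nlinarith) (by linarith)

/-- With $q$ equal to 2 over the Markov number, this is $1-\sqrt{1-q^2}\le q$ for $0<q<1$. The true
order is $q^2$, but a linear bound suffices. -/
lemma radius_le {a : ℝ} (ha : 0 < a) {A : SL(2, ℝ)} (hA : IsElliptic A)
    (hm : 2 < number a A) : a / 2 - offset a A ≤ a / 2 * (2 / number a A) := by
  have h1 := offset_sq ha hA hm
  have h2 := offset_lt ha hA hm
  have h3 := offset_nonneg a A
  rw [inv_lower_sq_eq ha hA] at h1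
  have h4 : 2 / number a A < 1 := by
    rw [div_lt_one (by linarith)]
    exact hm
  have h5 : 0 < 2 / number a A := div_pos two_pos (by linarith)
  have e : a ^ 2 / number a A ^ 2 = (a / 2 * (2 / number a A)) ^ 2 := by
    field_simp
  rw [e] at h1
  have h6 : 0 < a / 2 * (2 / number a A) := by positivity
  have h7 : a / 2 * (2 / number a A) < a / 2 := by nlinarith
  nlinarith

/-- Configurations in which the first Markov number dominates the product of the other two. -/
structure IsReduced (κ X a : ℝ) (t : Triple) : Prop extends IsConfig a t where
  dominant : κ * (number a t.F * number a t.G) ≤ number a t.E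
  le_F : a ≤ number a t.F
  le_G : a ≤ number a t.G
  axis_le : axis t.F ≤ X

namespace IsReduced

variable {κ X a : ℝ} {t : Triple}

lemma le_E (h : IsReduced κ X a t) (ha : 2 < a) (hκ : 1 / 2 < κ) : a ≤ number a t.E := by
  have h1 := h.dominant
  have h2 := h.le_F
  have h3 := h.le_G
  have : number a t.F * 2 ≤ number a t.F * number a t.G :=
    mul_le_mul_of_nonneg_left (by linarith) (by linarith)
  nlinarith

lemma two_mul_le (h : IsReduced κ X a t) (ha : 2 < a) (hκ : 1 / 2 < κ) :
    number a t.F * number a t.G ≤ 2 * number a t.E := by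
  have h1 := h.dominant
  have h2 : 0 ≤ number a t.F * number a t.G :=
    mul_nonneg (by linarith [h.le_F]) (by linarith [h.le_G])
  nlinarith

/-- Turns dominance into a spacing condition. Its inheritance is then visible: `lam` moves the left
point further left, and `rho` moves the right point further right. -/
lemma dominant_iff (h : IsConfig a t) (ha : 0 < a) :
    κ * (number a t.F * number a t.G) ≤ number a t.E ↔ κ * a ≤ axis t.G - axis t.F := by
  have h2 := number_pos ha h.ellF
  have h3 := number_pos ha h.ellG
  rw [h.gapFG, le_div_iff₀ (by positivity), mul_right_comm, mul_comm _ a,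
    mul_le_mul_iff_right₀ ha]

lemma lam (h : IsReduced κ X a t) (ha : 2 < a) (hκ : 1 / 2 < κ) :
    IsReduced κ X a (lam t) where
  toIsConfig := h.toIsConfig.lam (by linarith)
  dominant := by
    have h0 : 0 < a := by linarith
    rw [dominant_iff (h.toIsConfig.lam h0) h0]
    have h1 := (dominant_iff h.toIsConfig h0).1 h.dominant
    have h2 := h.axis_E_lt_F h0
    simp only [Uplift.lam]
    linarith
  le_F := h.le_E ha hκ
  le_G := h.le_G
  axis_le := (h.axis_E_lt_F (by linarith)).le.trans h.axis_le

lemma rho (h : IsReduced κ X a t) (ha : 2 < a) (hκ : 1 / 2 < κ) :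
    IsReduced κ X a (rho a t) where
  toIsConfig := h.toIsConfig.rho (by linarith)
  dominant := by
    have h0 : 0 < a := by linarith
    rw [dominant_iff (h.toIsConfig.rho h0) h0]
    have h1 := (dominant_iff h.toIsConfig h0).1 h.dominant
    have h2 := h.gapGE
    have h3 := number_pos h0 h.ellE
    have h4 := number_pos h0 h.ellF
    have h5 := number_pos h0 h.ellG
    have h6 : 0 < a * number a t.F / (number a t.G * number a t.E) := by positivity
    simp only [Uplift.rho, axis_translate a h.ellE]
    linarith
  le_F := h.le_F
  le_G := by
    simp only [Uplift.rho, number_translate]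
    exact h.le_E ha hκ
  axis_le := h.axis_le

lemma subtree (h : IsReduced κ X a t) (ha : 2 < a) (hκ : 1 / 2 < κ) {t' : Triple}
    (ht : Subtree a t t') : IsReduced κ X a t' := by
  induction ht with
  | root => exact h
  | lam _ ih => exact ih.lam ha hκ
  | rho _ ih => exact ih.rho ha hκ

lemma weightedTree (ha : 2 < a) (hκ : 1 / 2 < κ) :
    WeightedTree Uplift.lam (Uplift.rho a) (IsReduced κ X a) (fun t => 2 / number a t.F)
      (fun t => 2 / number a t.G) := by
  have key : ∀ t, IsReduced κ X a t →
      2 / number a t.E ≤ 2 / number a t.F * (2 / number a t.G) := by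
    intro t h
    have h2 := h.le_F
    have h3 := h.le_G
    have h4 := h.le_E ha hκ
    have := h.two_mul_le ha hκ
    rw [div_mul_div_comm, div_le_div_iff₀ (by linarith)
      (mul_pos (by linarith) (by linarith))]
    linarith
  refine ⟨fun t h => h.lam ha hκ, fun t h => h.rho ha hκ, fun t h => ?_, fun t h => ?_,
    fun t h => ?_, fun t h => ?_, key, fun t h => le_rfl, fun t h => le_rfl, fun t h => ?_⟩
  · exact div_pos two_pos (by linarith [h.le_F])
  · rw [div_lt_one] <;> linarith [h.le_F]
  · exact div_pos two_pos (by linarith [h.le_G])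
  · rw [div_lt_one] <;> linarith [h.le_G]
  · simpa only [Uplift.rho, number_translate] using key t h

lemma gap_length_le (h : IsReduced κ X a t) (ha : 2 < a) (hκ : 1 / 2 < κ) :
    leftEnd a t.F - (rightEnd a t.G - a) ≤
      a / (2 * (2 * κ - 1)) * (2 / number a t.F * (2 / number a t.G)) := by
  have h0 : 0 < a := by linarith
  have hF : 2 < number a t.F := by linarith [h.le_F]
  have hG : 2 < number a t.G := by linarith [h.le_G]
  have nE := number_pos h0 h.ellE
  have nF := number_pos h0 h.ellF
  have nG := number_pos h0 h.ellG
  have sF := offset_sq h0 h.ellF hF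
  have sG := offset_sq h0 h.ellG hG
  rw [inv_lower_sq_eq h0 h.ellF] at sF
  rw [inv_lower_sq_eq h0 h.ellG] at sG
  have hD := (dominant_iff h.toIsConfig h0).1 h.dominant
  -- Here $D$ is the distance between the centers of the two excision intervals flanking the gap.
  -- With half-period minus offset as radii, each summand on the right is $r(a-r)$, so the quadratic
  -- estimate applies.
  have eD : (axis t.F + a - axis t.G) * (axis t.G - axis t.F) =
      a ^ 2 / number a t.F ^ 2 + a ^ 2 / number a t.G ^ 2 := by
    have e1 : axis t.F + a - axis t.G = a * number a t.G / (number a t.E * number a t.F) +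
        a * number a t.F / (number a t.G * number a t.E) := by
      rw [← h.gapEF, ← h.gapGE]
      ring
    rw [e1, h.gapFG]
    field_simp
  have rF := radius_le h0 h.ellF hF
  have rG := radius_le h0 h.ellG hG
  have pF := sub_nonneg.2 (offset_lt h0 h.ellF hF).le
  have pG := sub_nonneg.2 (offset_lt h0 h.ellG hG).le
  have main := sub_sub_le_of_mul_sub_eq (D := axis t.F + a - axis t.G) h0 hκ pF pG
    (by linarith [offset_nonneg a t.F]) (by linarith [offset_nonneg a t.G]) (by linarith)
    (by rw [show a - (axis t.F + a - axis t.G) = axis t.G - axis t.F by ring, eD]; linarith)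
  have hpos : 0 < 2 * κ - 1 := by linarith
  calc leftEnd a t.F - (rightEnd a t.G - a)
      = axis t.F + a - axis t.G - (a / 2 - offset a t.F) - (a / 2 - offset a t.G) := by
        unfold leftEnd rightEnd
        ring
    _ ≤ 2 * (a / 2 - offset a t.F) * (a / 2 - offset a t.G) / (a * (2 * κ - 1)) := main
    _ ≤ 2 * (a / 2 * (2 / number a t.F)) * (a / 2 * (2 / number a t.G)) / (a * (2 * κ - 1)) := by
        gcongr
    _ = _ := by
        field_simp

end IsReduced

/-! ### Covering the residual set of a gap at each depth -/

lemma Subtree.trans {a : ℝ} {t t' t'' : Triple} (h : Subtree a t t') (h' : Subtree a t' t'') :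
    Subtree a t t'' := by
  induction h' with
  | root => exact h
  | lam _ ih => exact ih.lam
  | rho _ ih => exact ih.rho

/-- The part of the gap below a node left over by the excision intervals of its descendants. -/
def residualGap (a : ℝ) (t : Triple) : Set ℝ :=
  {x | x ∈ Set.Icc (rightEnd a t.G - a) (leftEnd a t.F) ∧
    ∀ t', Subtree a t t' → x ∉ Set.Ioo (leftEnd a t'.E) (rightEnd a t'.E)}

/-- A point avoiding the interval of `E` lies to its left, in the gap of the `lam`-child, or to its
right, in the gap of the `rho`-child, and remains residual there. -/
lemma exists_mem_levelList_of_mem_residualGap {κ X a : ℝ} (ha : 2 < a) (hκ : 1 / 2 < κ) (n : ℕ)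
    {t : Triple} (ht : IsReduced κ X a t) {x : ℝ} (hx : x ∈ residualGap a t) :
    ∃ t' ∈ levelList lam (rho a) n t, x ∈ Set.Icc (rightEnd a t'.G - a) (leftEnd a t'.F) := by
  induction n generalizing t with
  | zero => exact ⟨t, by simp [levelList], hx.1⟩
  | succ n ih =>
    obtain ⟨⟨h1, h2⟩, h3⟩ := hx
    rcases le_or_gt x (leftEnd a t.E) with hl | hl
    · obtain ⟨t', ht', hx'⟩ := ih (ht.lam ha hκ)
        ⟨⟨h1, hl⟩, fun t' ht' => h3 t' (Subtree.root.lam.trans ht')⟩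
      exact ⟨t', List.mem_append_left _ ht', hx'⟩
    · rcases lt_or_ge x (rightEnd a t.E) with hr | hr
      · exact absurd ⟨hl, hr⟩ (h3 t Subtree.root)
      · obtain ⟨t', ht', hx'⟩ := ih (ht.rho ha hκ)
          ⟨⟨by simpa [rho, rightEnd_translate a ht.ellE] using hr, h2⟩,
            fun t' ht' => h3 t' (Subtree.root.rho.trans ht')⟩
        exact ⟨t', List.mem_append_right _ ht', hx'⟩

lemma dimH_residualGap {κ X a : ℝ} (ha : 2 < a) (hκ : 1 / 2 < κ) {t : Triple}
    (ht : IsReduced κ X a t) : dimH (residualGap a t) = 0 := by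
  have hpos : 0 < 2 * κ - 1 := by linarith
  exact (IsReduced.weightedTree (X := X) ha hκ).dimH_eq_zero ht
    (fun t => rightEnd a t.G - a) (fun t => leftEnd a t.F) (by positivity)
    (fun t h => h.gap_length_le ha hκ)
    (fun n _ hx => exists_mem_levelList_of_mem_residualGap ha hκ n ht hx)

/-! ### The three root gaps and the conclusion -/

namespace FrickeTriple

variable (f : FrickeTriple)

/-- The lower bound for the ratio of the largest Markov number to the product of the others. -/
def ratio : ℝ := 1 - f.c / (f.a * f.b)

lemma half_lt_ratio : 1 / 2 < f.ratio := by
  have h := mul_pos f.a_pos f.b_pos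
  have : f.c / (f.a * f.b) < 1 / 2 := by
    rw [div_lt_div_iff₀ h two_pos]
    linarith [f.c_lt]
  unfold ratio
  linarith

lemma isElliptic_T₀ : IsElliptic f.T₀ := by
  have := f.a_pos.ne'
  have := f.c_pos.ne'
  simp [IsElliptic, T₀, *]

lemma isElliptic_T₁ : IsElliptic f.T₁ := by
  have := f.a_pos.ne'
  have := f.b_pos.ne'
  simp [IsElliptic, T₁, *]

lemma isElliptic_T₂ : IsElliptic f.T₂ := by
  simp [IsElliptic, T₂]
  ring

lemma axis_T₀ : axis f.T₀ = 0 := by simp [axis, T₀]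

lemma axis_T₁ : axis f.T₁ = f.a ^ 2 / (f.b * f.c) := by
  have := f.a_pos.ne'
  have := f.b_pos.ne'
  have := f.c_pos.ne'
  simp [axis, T₁]
  field_simp

lemma axis_T₂ : axis f.T₂ = f.a - f.b / f.c := by simp [axis, T₂]

lemma number_T₀ : number f.a f.T₀ = f.c := by
  have h1 := f.a_pos
  have h2 := f.c_pos
  have : |f.c / f.a| = f.c / f.a := abs_of_pos (by positivity)
  simp only [number, T₀, Matrix.of_apply, Matrix.cons_val', Matrix.cons_val_zero,
    Matrix.cons_val_one, Matrix.cons_val_fin_one, this]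
  field_simp

lemma number_T₁ : number f.a f.T₁ = f.b := by
  have h1 := f.a_pos
  have h2 := f.b_pos
  have : |f.b / f.a| = f.b / f.a := abs_of_pos (by positivity)
  simp only [number, T₁, Matrix.of_apply, Matrix.cons_val', Matrix.cons_val_zero,
    Matrix.cons_val_one, Matrix.cons_val_fin_one, this]
  field_simp

lemma number_T₂ : number f.a f.T₂ = f.a := by simp [number, T₂]

lemma isConfig_initial : IsConfig f.a f.initial := by
  have h1 := f.a_pos
  have h2 := f.b_pos
  have h3 := f.c_pos
  have h4 := f.fricke
  refine ⟨f.isElliptic_T₀, f.isElliptic_T₁, f.isElliptic_T₂, ?_, ?_, ?_⟩ <;>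
    simp only [initial, axis_T₀, axis_T₁, axis_T₂, number_T₀, number_T₁, number_T₂]
  · field_simp
    ring
  · field_simp
    linarith
  · field_simp
    ring

lemma isReduced_lam : IsReduced f.ratio (axis f.T₂) f.a (lam f.initial) where
  toIsConfig := f.isConfig_initial.lam f.a_pos
  dominant := by
    have h1 := f.a_pos
    have h2 := f.b_pos
    have h3 := f.b_le_c
    have e := f.isConfig_initial.number_lam f.a_pos
    simp only [initial, number_T₀, number_T₁, number_T₂] at e
    simp only [lam, initial, e, number_T₀, number_T₂, ratio]
    -- The right side is $c^2/b$, so this is $b\le c$; it gives $ca-b\ge\kappa\,ca$.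
    have : f.b ≤ f.c / (f.a * f.b) * (f.c * f.a) := by
      rw [div_mul_eq_mul_div, le_div_iff₀ (by positivity)]
      nlinarith [mul_le_mul h3 h3 h2.le (h2.le.trans h3)]
    linarith
  le_F := by
    simp only [lam, initial, number_T₀]
    exact f.a_le_b.trans f.b_le_c
  le_G := by simp only [lam, initial, number_T₂, le_refl]
  axis_le := by
    have h1 := f.isConfig_initial.axis_E_lt_F f.a_pos
    have h2 := f.isConfig_initial.rotate.axis_E_lt_F f.a_pos
    exact (h1.trans h2).le

lemma isReduced_rho : IsReduced f.ratio (axis f.T₂) f.a (rho f.a f.initial) where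
  toIsConfig := f.isConfig_initial.rho f.a_pos
  dominant := by
    have h1 := f.a_pos
    have h2 := f.b_pos
    have h3 := f.a_le_b.trans f.b_le_c
    have e := f.isConfig_initial.number_rho f.a_pos
    simp only [initial, number_T₀, number_T₁, number_T₂] at e
    simp only [rho, initial, e, number_T₀, number_T₁, number_translate, ratio]
    have : f.a ≤ f.c / (f.a * f.b) * (f.b * f.c) := by
      rw [div_mul_eq_mul_div, le_div_iff₀ (by positivity)]
      nlinarith [mul_le_mul h3 h3 h1.le (h1.le.trans h3)]
    linarith
  le_F := by
    simp only [rho, initial, number_T₁]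
    exact f.a_le_b
  le_G := by
    simp only [rho, initial, number_T₀, number_translate]
    exact f.a_le_b.trans f.b_le_c
  axis_le := (f.isConfig_initial.rotate.axis_E_lt_F f.a_pos).le

/-- This root fixes the value of `ratio`: here dominance is the equality $ab-c=\kappa ab$. -/
lemma isReduced_nu : IsReduced f.ratio (axis f.T₂) f.a (nu f.a f.initial) where
  toIsConfig := f.isConfig_initial.nu f.a_pos
  dominant := by
    have h1 := f.a_pos
    have h2 := f.b_pos
    have e := f.isConfig_initial.number_nu f.a_pos
    simp only [initial, number_T₀, number_T₁, number_T₂] at e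
    simp only [nu, initial, e, number_T₁, number_T₂, number_translate, ratio]
    have : f.c / (f.a * f.b) * (f.a * f.b) = f.c := div_mul_cancel₀ _ (by positivity)
    linarith
  le_F := by simp only [nu, initial, number_T₂, le_refl]
  le_G := by
    simp only [nu, initial, number_T₁, number_translate]
    exact f.a_le_b
  axis_le := le_rfl

/-- Since `T₂` is removed from the index set, `T` must be shown different from it; comparing fixed
points does this, which is why `IsReduced` carries the bound `X`. -/
lemma Ioo_subset_of_mem {T : SL(2, ℝ)} (hT : T ∈ f.elements) (hlt : axis T < axis f.T₂)
    (hell : IsElliptic T) (hnum : f.a ≤ number f.a T) :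
    Set.Ioo (leftEnd f.a T) (rightEnd f.a T) ⊆ ⋃ T ∈ f.indexSet, excisionInterval f.a T := by
  refine (Ioo_subset_excisionInterval f.a_pos hell (by linarith [f.two_lt_a])).trans ?_
  refine Set.subset_biUnion_of_mem (u := fun T => excisionInterval f.a T)
    (Set.mem_insert_of_mem _ ⟨hT, ?_⟩)
  rintro rfl
  exact lt_irrefl _ hlt

lemma mem_residualGap {t : Triple} (ht : IsReduced f.ratio (axis f.T₂) f.a t)
    (hnode : ∀ t', Subtree f.a t t' → f.IsNode t') {x : ℝ}
    (hx : x ∉ ⋃ T ∈ f.indexSet, excisionInterval f.a T)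
    (h1 : rightEnd f.a t.G - f.a ≤ x) (h2 : x ≤ leftEnd f.a t.F) : x ∈ residualGap f.a t := by
  refine ⟨⟨h1, h2⟩, fun t' ht' hx' => hx ?_⟩
  have hr := ht.subtree f.two_lt_a f.half_lt_ratio ht'
  exact f.Ioo_subset_of_mem ⟨t', hnode t' ht', Or.inl rfl⟩
    ((hr.axis_E_lt_F f.a_pos).trans_le hr.axis_le) hr.ellE
    (hr.le_E f.two_lt_a f.half_lt_ratio) hx'

lemma T₂'_eq : f.T₂' = S (-f.a) * f.T₂ * S (-(-f.a)) := by rw [neg_neg, T₂']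

lemma residualSet_subset : f.residualSet ⊆ {leftEnd f.a f.T₂'} ∪
    (residualGap f.a (lam f.initial) ∪ (residualGap f.a (rho f.a f.initial) ∪
      residualGap f.a (nu f.a f.initial))) := by
  have ha := f.a_pos
  have ha2 := f.two_lt_a
  have ell' : IsElliptic f.T₂' := by
    rw [T₂'_eq]
    exact isElliptic_translate _ f.isElliptic_T₂
  have num' : number f.a f.T₂' = f.a := by
    rw [T₂'_eq, number_translate, number_T₂]
  have right' : rightEnd f.a f.T₂' = rightEnd f.a f.T₂ - f.a := by
    simp only [rightEnd, offset, T₂'_eq, axis_translate _ f.isElliptic_T₂,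
      (translate_entries (-f.a) f.T₂).1]
    ring
  have lt01 := f.isConfig_initial.axis_E_lt_F ha
  have lt12 := f.isConfig_initial.rotate.axis_E_lt_F ha
  have hroot : f.IsNode f.initial := Or.inl Subtree.root
  rintro x ⟨⟨hx1, hx2⟩, hx⟩
  rw [sInf_onLine_upliftPlus ha ell' (by linarith)] at hx1
  rw [sInf_onLine_upliftPlus ha f.isElliptic_T₂ (by linarith [f.number_T₂])] at hx2
  -- The excision intervals are used as open intervals, so the left endpoint of the closed ambient
  -- interval is set aside as a singleton.
  rcases hx1.eq_or_lt with he | hx1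
  · exact Or.inl he.symm
  right
  have hr2 : rightEnd f.a f.T₂' ≤ x := by
    by_contra! hc
    exact hx (Set.mem_biUnion (Set.mem_insert _ _)
      (Ioo_subset_excisionInterval ha ell' (by linarith) ⟨hx1, hc⟩))
  rw [right'] at hr2
  rcases le_or_gt x (leftEnd f.a f.T₀) with h0 | h0
  · exact Or.inl (f.mem_residualGap f.isReduced_lam
      (fun t' ht' => Or.inl (Subtree.root.lam.trans ht')) hx hr2 h0)
  right
  have hr0 : rightEnd f.a f.T₀ ≤ x := by
    by_contra! hc
    refine hx (f.Ioo_subset_of_mem ⟨_, hroot, Or.inl rfl⟩ (lt01.trans lt12) f.isElliptic_T₀ ?_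
      ⟨h0, hc⟩)
    change f.a ≤ number f.a f.T₀
    rw [number_T₀]
    exact f.a_le_b.trans f.b_le_c
  rcases le_or_gt x (leftEnd f.a f.T₁) with h1 | h1
  · refine Or.inl (f.mem_residualGap f.isReduced_rho
      (fun t' ht' => Or.inl (Subtree.root.rho.trans ht')) hx ?_ h1)
    simpa [rho, initial, rightEnd_translate _ f.isElliptic_T₀] using hr0
  right
  have hr1 : rightEnd f.a f.T₁ ≤ x := by
    by_contra! hc
    refine hx (f.Ioo_subset_of_mem ⟨_, hroot, Or.inr (Or.inl rfl)⟩ lt12 f.isElliptic_T₁ ?_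
      ⟨h1, hc⟩)
    change f.a ≤ number f.a f.T₁
    rw [number_T₁]
    exact f.a_le_b
  refine f.mem_residualGap f.isReduced_nu (fun t' ht' => Or.inr ht') hx ?_ hx2
  simpa [nu, initial, rightEnd_translate _ f.isElliptic_T₁] using hr1

lemma dimH_residualSet : dimH f.residualSet = 0 := by
  refine le_antisymm ((dimH_mono f.residualSet_subset).trans ?_) zero_le
  rw [dimH_union, dimH_union, dimH_union, dimH_singleton,
    dimH_residualGap f.two_lt_a f.half_lt_ratio f.isReduced_lam,
    dimH_residualGap f.two_lt_a f.half_lt_ratio f.isReduced_rho,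
    dimH_residualGap f.two_lt_a f.half_lt_ratio f.isReduced_nu]
  simp

end FrickeTriple

end Uplift

end

theorem theorem5 (f : Uplift.FrickeTriple) :
    dimH f.residualSet = 0 ∧ MeasureTheory.volume f.residualSet = 0 := by
  refine ⟨f.dimH_residualSet, ?_⟩
  rw [← hausdorffMeasure_real]
  have h : dimH f.residualSet < ((1 : NNReal) : ENNReal) := by
    rw [f.dimH_residualSet]
    norm_num
  simpa using hausdorffMeasure_of_dimH_lt h
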